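/- Let $\alpha = dy - z\,dx$ on $\mathbb{R}^3$, let $\xi = \ker\alpha$, and let $X = \partial_x + z\,\partial_y$, $Z = \partial_z$ be its Legendrian framing. Let $\phi : (\mathbb{R}^3,\xi) \to (\mathbb{R}^3,\xi)$ be a contactomorphism (a $C^\infty$ diffeomorphism with $d\phi(\xi)=\xi$) with $\phi(0)=0$ and $\phi^*\alpha = \lambda\alpha$, and suppose that the conformal factor at the origin satisfies $\lambda(0) \neq 1$. Let $M_\phi$ be the mapping torus, i.e. $\mathbb{R}^3\times[0,1]$ with $(p,1)$ glued to $(\phi(p),0)$; equivalently, the quotient of $\mathbb{R}^3\times\mathbb{R}$ by the $\mathbb{Z}$-action generated by $T(p,t)=(\phi(p),t-1)$. Let $\mathcal{D}$ be an Engel structure of smallest turning on $M_\phi$. That is, $\mathcal{D}$ is induced by a $T$-invariant plane field $\langle \partial_t,\ \cos(f)X + \sin(f)Z\rangle$ on $\mathbb{R}^3\times\mathbb{R}$, where $f : \mathbb{R}^3\times\mathbb{R}\to\mathbb{R}$ is $C^\infty$ with $\partial_t f>0$, $f(\cdot,0) = 0$, and $f(\cdot,1)$ is the (pointwise) smallest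 among all smooth positive functions $F$ on $\mathbb{R}^3$ for which $\cos(F)X+\sin(F)Z$ spans the line field $\phi^*\langle X\rangle$. Then $\mathcal{D}$ is an Engel structure. Let $\mathcal{W}$ be its kernel, i.e. the line field $\mathcal{W}\subset\mathcal{D}$ with $[\mathcal{W},\mathcal{E}]\subset\mathcal{E}$ for $\mathcal{E}=[\mathcal{D},\mathcal{D}]$. The loop $\gamma(\theta) = (0,0,0,\theta)$, $\theta\in\mathbb{R}/\mathbb{Z}$, is an immersed loop in $M_\phi$ everywhere tangent to $\mathcal{W}$, and it admits horizontal deformations somewhere not tangent to $\mathcal{W}$: there is a smooth family $(\gamma_s)_{s\in[0,1]}$ of smooth immersed loops in $M_\phi$ tangent to $\mathcal{D}$ such that $\gamma_0=\gamma$ and, for every $s\in(0,1]$, the loop $\gamma_s$ is somewhere not tangent to $\mathcal{W}$. In particular, such loops exist arbitrarily $C^1$-close to $\gamma$. -/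

import Mathlib

open Set
open scoped ContDiff

/-- Euclidean three-space with coordinates `p = (x, y, z)`: `x = p.1`, `y = p.2.1`, `z = p.2.2`. -/
abbrev R3 : Type := ℝ × ℝ × ℝ

/-- `ℝ³ × ℝ` with coordinates `((x, y, z), t)`. -/
abbrev R4 : Type := R3 × ℝ

/-! ### Distributions, Engel structures and their kernels -/

section Distributions

variable {V : Type*} [NormedAddCommGroup V] [NormedSpace ℝ V]

/-- `D` is a smooth distribution of rank `k` on the vector space `V`: near every point it is
spanned by a smooth frame of `k` linearly independent vector fields. -/
def IsSmoothDistribution (k : ℕ) (D : V → Submodule ℝ V) : Prop :=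
  ∀ p : V, ∃ U : Set V, IsOpen U ∧ p ∈ U ∧ ∃ X : Fin k → V → V,
    (∀ i, ContDiffOn ℝ ∞ (X i) U) ∧
    ∀ q ∈ U, LinearIndependent ℝ (fun i => X i q) ∧
      Submodule.span ℝ (range fun i => X i q) = D q

/-- `X` is a smooth vector field tangent to `D`. -/
def IsSectionOf (D : V → Submodule ℝ V) (X : V → V) : Prop :=
  ContDiff ℝ ∞ X ∧ ∀ p, X p ∈ D p

/-- The distribution `[D, D]`, generated by `D` and by the Lie brackets of vector fields tangent
to `D`. -/
def derivedDistribution (D : V → Submodule ℝ V) (p : V) : Submodule ℝ V :=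
  D p ⊔ Submodule.span ℝ
    {v | ∃ X Y : V → V, IsSectionOf D X ∧ IsSectionOf D Y ∧ v = VectorField.lieBracket ℝ X Y p}

/-- `D` is an Engel structure (on a four-dimensional `V`): `D` is a smooth rank two distribution,
`E = [D, D]` is a smooth rank three distribution, and `[E, E]` is the whole tangent space. -/
def IsEngel (D : V → Submodule ℝ V) : Prop :=
  IsSmoothDistribution 2 D ∧
  IsSmoothDistribution 3 (derivedDistribution D) ∧
  ∀ p, derivedDistribution (derivedDistribution D) p = ⊤

/-- The kernel `W ⊆ D` of an Engel structure: with `E = [D, D]`, the space `W p` consists of the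
values at `p` of the vector fields `X` tangent to `D` with `[X, E] ⊆ E`. -/
def engelKernel (D : V → Submodule ℝ V) (p : V) : Submodule ℝ V :=
  Submodule.span ℝ
    {v | ∃ X : V → V, IsSectionOf D X ∧
      (∀ Y : V → V, IsSectionOf (derivedDistribution D) Y →
        ∀ q, VectorField.lieBracket ℝ X Y q ∈ derivedDistribution D q) ∧
      v = X p}

end Distributions

/-! ### The standard contact structure on `ℝ³` -/

/-- The contact form `α = dy - z dx`. -/
noncomputable def contactForm (p : R3) : R3 →L[ℝ] ℝ :=
  (ContinuousLinearMap.fst ℝ ℝ ℝ).comp (ContinuousLinearMap.snd ℝ ℝ (ℝ × ℝ))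
    - p.2.2 • ContinuousLinearMap.fst ℝ ℝ (ℝ × ℝ)

/-- The contact structure `ξ = ker α`. -/
noncomputable def contactPlane (p : R3) : Submodule ℝ R3 :=
  LinearMap.ker (contactForm p).toLinearMap

/-- `φ` is a contactomorphism of `(ℝ³, ξ)`: a diffeomorphism carrying `ξ` to `ξ`. -/
structure IsContactomorphism (φ : R3 ≃ R3) : Prop where
  smooth : ContDiff ℝ ∞ φ
  smooth_symm : ContDiff ℝ ∞ φ.symm
  map_contactPlane : ∀ p,
    (contactPlane p).map (fderiv ℝ φ p).toLinearMap = contactPlane (φ p)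

/-- `lam` is the conformal factor of `φ`, that is, `φ^* α = lam α`. -/
def IsConformalFactor (φ : R3 ≃ R3) (lam : R3 → ℝ) : Prop :=
  ∀ p v, contactForm (φ p) (fderiv ℝ φ p v) = lam p * contactForm p v

/-- The Legendrian vector field `X = ∂_x + z ∂_y`. -/
def frameX (p : R3) : R3 := (1, p.2.2, 0)

/-- The Legendrian vector field `Z = ∂_z`. -/
def frameZ : R3 := (0, 0, 1)

/-- The Legendrian vector at `p` of angle `a` with respect to the framing `X, Z` of `ξ`. -/
noncomputable def legendrian (a : ℝ) (p : R3) : R3 :=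
  Real.cos a • frameX p + Real.sin a • frameZ

/-! ### The mapping torus -/

/-- The deck transformation `(p, t) ↦ (φ p, t - 1)` of `ℝ³ × ℝ`. It realises the gluing
`(p, 1) ∼ (φ p, 0)`. -/
def deck (φ : R3 ≃ R3) : Equiv.Perm R4 :=
  φ.prodCongr (Equiv.subRight (1 : ℝ))

/-- The mapping torus `M_φ`, that is `ℝ³ × [0, 1]` with `(p, 1)` glued to `(φ p, 0)`, presented as
the quotient of `ℝ³ × ℝ` by the free, properly discontinuous action of `ℤ` generated by `deck φ`.
For a diffeomorphism `φ` the quotient map is the universal covering of `M_φ`. -/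
abbrev MappingTorus (φ : R3 ≃ R3) : Type :=
  MulAction.orbitRel.Quotient (Subgroup.zpowers (deck φ)) R4

/-- The covering map `ℝ³ × ℝ → M_φ`. -/
def toTorus (φ : R3 ≃ R3) (q : R4) : MappingTorus φ :=
  Quotient.mk (MulAction.orbitRel (Subgroup.zpowers (deck φ)) R4) q

theorem toTorus_deck (φ : R3 ≃ R3) (q : R4) : toTorus φ (deck φ q) = toTorus φ q :=
  Quotient.sound (s := MulAction.orbitRel (Subgroup.zpowers (deck φ)) R4)
    ⟨⟨deck φ, Subgroup.mem_zpowers _⟩, rfl⟩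

/-- The circle `ℝ / ℤ`. -/
abbrev S1 : Type := AddCircle (1 : ℝ)

/-- The loop `γ(θ) = (0, 0, 0, θ)` in `M_φ`, for `φ` fixing the origin. -/
noncomputable def zeroOrbit (φ : R3 ≃ R3) (h0 : φ 0 = 0) : S1 → MappingTorus φ :=
  Function.Periodic.lift (f := fun θ : ℝ => toTorus φ ((0 : R3), θ)) (c := 1) (by
    intro θ
    have h : deck φ ((0 : R3), θ + 1) = ((0 : R3), θ) := by
      simp [deck, h0]
    have h' := toTorus_deck φ ((0 : R3), θ + 1)
    rw [h] at h'
    exact h'.symm)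

/-! ### The Engel structure of smallest turning -/

/-- The plane field `⟨∂_t, L⟩` on `ℝ³ × ℝ` with `L = cos f X + sin f Z`. -/
noncomputable def turningPlane (f : R4 → ℝ) (q : R4) : Submodule ℝ R4 :=
  Submodule.span ℝ {((0 : R3), (1 : ℝ)), (legendrian (f q) q.1, (0 : ℝ))}

/-- The smooth positive functions `F` on `ℝ³` for which `cos F X + sin F Z` spans the line field
`φ^* ⟨X⟩`, that is, the possible values at time `1` of the angle of a Legendrian field `L` which
starts at `L(0) = X`, rotates positively and is compatible with the gluing of `M_φ`. -/
def positiveReturnAngles (φ : R3 ≃ R3) : Set (R3 → ℝ) :=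
  {F | ContDiff ℝ ∞ F ∧ (∀ p, 0 < F p) ∧
    ∀ p, Submodule.span ℝ {legendrian (F p) p} =
      (Submodule.span ℝ {frameX (φ p)}).comap (fderiv ℝ φ p).toLinearMap}

/-- `f` is the angle function of a structure of smallest turning on `M_φ`: the plane field
`⟨∂_t, cos f X + sin f Z⟩` on the covering `ℝ³ × ℝ` is invariant under the deck transformation,
i.e. descends to a smooth plane field on `M_φ`; the angle is `0` at time `0`, strictly increases
with `t`, and at time `1` is the smallest positive function compatible with the gluing. -/
structure IsSmallestTurning (φ : R3 ≃ R3) (f : R4 → ℝ) : Prop where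
  smooth : ContDiff ℝ ∞ f
  zero : ∀ p, f (p, 0) = 0
  turning : ∀ p t, 0 < deriv (fun τ : ℝ => f (p, τ)) t
  invariant : ∀ q,
    (turningPlane f q).map (fderiv ℝ (deck φ) q).toLinearMap = turningPlane f (deck φ q)
  least : IsLeast (positiveReturnAngles φ) (fun p => f (p, 1))

/-! ### Horizontal loops in the mapping torus

Tangency to a deck-invariant distribution is tested on lifts to the covering `ℝ³ × ℝ`. Any two
smooth lifts of a loop differ by a power of the deck transformation, so the choice of the lift does
not matter. -/

/-- `η` is a smooth lift to `ℝ³ × ℝ` of the loop `c` in `M_φ`. A loop is smooth if and only if it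
has such a lift. -/
def IsSmoothLift {φ : R3 ≃ R3} (c : S1 → MappingTorus φ) (η : ℝ → R4) : Prop :=
  ContDiff ℝ ∞ η ∧ ∀ θ : ℝ, toTorus φ (η θ) = c (θ : S1)

/-- `c` is a smooth immersed loop in `M_φ` that is everywhere tangent to `D`. -/
def IsHorizontalImmersion {φ : R3 ≃ R3} (D : R4 → Submodule ℝ R4) (c : S1 → MappingTorus φ) :
    Prop :=
  ∃ η : ℝ → R4, IsSmoothLift c η ∧ ∀ θ, deriv η θ ≠ 0 ∧ deriv η θ ∈ D (η θ)

/-- The smooth loop `c` is somewhere not tangent to `W`. -/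
def SomewhereNotTangent {φ : R3 ≃ R3} (W : R4 → Submodule ℝ R4) (c : S1 → MappingTorus φ) :
    Prop :=
  ∃ η : ℝ → R4, IsSmoothLift c η ∧ ∃ θ, deriv η θ ∉ W (η θ)

/-- `h s`, `s ∈ [0, 1]`, is a family of loops in `M_φ` depending smoothly on the parameter and on
the point of the circle. In particular `s ↦ h s` is continuous in the `C¹`-topology (and in every
`Cʳ`-topology). -/
def IsSmoothFamily {φ : R3 ≃ R3} (h : ℝ → S1 → MappingTorus φ) : Prop :=
  ∃ H : ℝ × ℝ → R4, ContDiffOn ℝ ∞ H (Icc (0 : ℝ) 1 ×ˢ univ) ∧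
    ∀ s ∈ Icc (0 : ℝ) 1, ∀ θ : ℝ, toTorus φ (H (s, θ)) = h s (θ : S1)

/-!
The kernel of the Engel structure `D = ⟨∂_t, L⟩` is `⟨∂_t⟩`: by Cartan's formula
(`lieBracket_contactForm`), `α([V, W]) = -(dx ∧ dz)(V, W)` for fields with values in
`E = ker α = ⟨∂_t, X, Z⟩`, so that `[D, D] = E`, `[E, E]` is everything, and a field in `D` preserves
`E` exactly when it has no component in `ξ`.

For the deformation, a horizontal curve with `t' > 0` is a Legendrian curve `p` in `ℝ³` with
`p' = c L`, together with times `t` at which `L` has the direction of `p'`. The angle function of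
the arc is fixed to be the one of the orbit of the origin, `g(θ) = f(0, θ)`. Then `p` is given by
explicit integrals, polynomial in the coefficients of `c` (`legendrianArc`), and `t` is recovered
from `f(p, t) = g` because `f` increases in `t` (`exists_time_of_angle`); no differential equation
has to be solved.

The arc closes up in the mapping torus if `p(1) = φ⁻¹(p(0))`. Take `c = s u₀ + a u₁ + b u₂` and
`p(0) = (0, y, 0)`. This equation for `(a, y, b)` is solved by the implicit function theorem at
`s = 0`: modulo `ξ` the derivative in `y` is nonzero since `λ(0) ≠ 1`, and the derivatives in `a`
and `b` span `ξ` because `L` turns (`turning_directions_independent`). For `s ≠ 0` the arc moves on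
the support of `u₀`, which is disjoint from those of `u₁` and `u₂`, and there it is not tangent to
the kernel. The arcs are vertical near their ends, so that their extensions by the deck
transformations are smooth (`deckExtension_eq`).
-/

open Filter Topology

/-! ### The Engel structure and its kernel -/

/-- The plane `ξ ⊕ ⟨∂_t⟩` in `ℝ³ × ℝ`: the preimage of the contact structure under the projection
to `ℝ³`. -/
noncomputable def contactPreimage (q : R4) : Submodule ℝ R4 :=
  (contactPlane q.1).comap (LinearMap.fst ℝ R3 ℝ)

theorem mem_contactPreimage {q v : R4} :
    v ∈ contactPreimage q ↔ v.1.2.1 = q.1.2.2 * v.1.1 := by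
  simp [contactPreimage, contactPlane, contactForm, sub_eq_zero]

theorem mem_turningPlane {f : R4 → ℝ} {q v : R4} :
    v ∈ turningPlane f q ↔ ∃ a : ℝ, v.1 = a • legendrian (f q) q.1 := by
  rw [turningPlane, Submodule.mem_span_pair]
  constructor
  · rintro ⟨a, b, rfl⟩
    exact ⟨b, by simp⟩
  · rintro ⟨b, hb⟩
    exact ⟨v.2, b, by ext1 <;> simp [hb]⟩

theorem legendrian_eq (a : ℝ) (p : R3) :
    legendrian a p = (Real.cos a, Real.cos a * p.2.2, Real.sin a) := by
  simp [legendrian, frameX, frameZ]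

theorem turningPlane_le_contactPreimage (f : R4 → ℝ) (q : R4) :
    turningPlane f q ≤ contactPreimage q := by
  intro v hv
  obtain ⟨a, ha⟩ := mem_turningPlane.1 hv
  rw [mem_contactPreimage, ha, legendrian_eq]
  simp
  ring

/-- For vector fields `V`, `W` in the kernel of `α`, Cartan's formula gives
`α([V, W]) = - dα(V, W) = - (dx ∧ dz)(V, W)`. -/
theorem lieBracket_contactForm {V W : R4 → R4} (hV : IsSectionOf contactPreimage V)
    (hW : IsSectionOf contactPreimage W) (q : R4) :
    (VectorField.lieBracket ℝ V W q).1.2.1 - q.1.2.2 * (VectorField.lieBracket ℝ V W q).1.1 =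
      (V q).1.2.2 * (W q).1.1 - (W q).1.2.2 * (V q).1.1 := by
  have key : ∀ {Y : R4 → R4}, IsSectionOf contactPreimage Y → ∀ v : R4,
      (fderiv ℝ Y q v).1.2.1 = v.1.2.2 * (Y q).1.1 + q.1.2.2 * (fderiv ℝ Y q v).1.1 := by
    intro Y hY v
    have hd := ((hY.1.differentiable (by simp)) q).hasFDerivAt
    have h1 : HasFDerivAt (fun q => (Y q).1.2.1) _ q := hd.fst.snd.fst
    have h2 : HasFDerivAt (fun q : R4 => q.1.2.2 * (Y q).1.1) _ q :=
      (hasFDerivAt_id (𝕜 := ℝ) q).fst.snd.snd.mul hd.fst.fst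
    have h3 : (fun q => (Y q).1.2.1) = fun q : R4 => q.1.2.2 * (Y q).1.1 :=
      funext fun q => mem_contactPreimage.1 (hY.2 q)
    rw [h3] at h1
    have := DFunLike.congr_fun (h1.unique h2) v
    simp at this
    linarith
  have e1 := key hV (W q)
  have e2 := key hW (V q)
  rw [VectorField.lieBracket]
  simp only [Prod.fst_sub, Prod.snd_sub]
  rw [e1, e2]
  ring

/-- The field `∂_t` on `ℝ³ × ℝ`. -/
def verticalField (_ : R4) : R4 := ((0 : R3), (1 : ℝ))

/-- The field `X = ∂_x + z ∂_y`, lifted to `ℝ³ × ℝ`. -/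
def liftX (q : R4) : R4 := (frameX q.1, (0 : ℝ))

/-- The field `Z = ∂_z`, lifted to `ℝ³ × ℝ`. -/
def liftZ (_ : R4) : R4 := (frameZ, (0 : ℝ))

/-- The Legendrian field `L = cos f X + sin f Z`, lifted to `ℝ³ × ℝ`. -/
noncomputable def liftL (f : R4 → ℝ) (q : R4) : R4 := (legendrian (f q) q.1, (0 : ℝ))

theorem contDiff_liftX : ContDiff ℝ ∞ liftX := by
  unfold liftX frameX
  fun_prop

theorem contDiff_liftL {f : R4 → ℝ} (hf : ContDiff ℝ ∞ f) : ContDiff ℝ ∞ (liftL f) := by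
  have : liftL f = fun q => ((Real.cos (f q), Real.cos (f q) * q.1.2.2, Real.sin (f q)), 0) := by
    funext q
    rw [liftL, legendrian_eq]
  rw [this]
  fun_prop

theorem liftX_mem (q : R4) : liftX q ∈ contactPreimage q := by
  simp [mem_contactPreimage, liftX, frameX]

theorem liftZ_mem (q : R4) : liftZ q ∈ contactPreimage q := by
  simp [mem_contactPreimage, liftZ, frameZ]

theorem isSectionOf_liftX : IsSectionOf contactPreimage liftX := ⟨contDiff_liftX, liftX_mem⟩

theorem isSectionOf_liftZ : IsSectionOf contactPreimage liftZ := ⟨contDiff_const, liftZ_mem⟩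

theorem isSectionOf_verticalField (f : R4 → ℝ) : IsSectionOf (turningPlane f) verticalField :=
  ⟨contDiff_const, fun _ => mem_turningPlane.2 ⟨0, by simp [verticalField]⟩⟩

theorem isSectionOf_liftL {f : R4 → ℝ} (hf : ContDiff ℝ ∞ f) :
    IsSectionOf (turningPlane f) (liftL f) :=
  ⟨contDiff_liftL hf, fun _ => mem_turningPlane.2 ⟨1, by simp [liftL]⟩⟩

theorem IsSectionOf.of_turningPlane {f : R4 → ℝ} {V : R4 → R4}
    (hV : IsSectionOf (turningPlane f) V) : IsSectionOf contactPreimage V :=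
  ⟨hV.1, fun q => turningPlane_le_contactPreimage f q (hV.2 q)⟩

theorem hasDerivAt_snd_param {f : R4 → ℝ} (hf : ContDiff ℝ ∞ f) (q : R4) :
    HasDerivAt (fun τ : ℝ => f (q.1, τ)) (fderiv ℝ f q ((0 : R3), (1 : ℝ))) q.2 :=
  ((hf.differentiable (by simp)) q).hasFDerivAt.comp_hasDerivAt (f := fun τ : ℝ => (q.1, τ)) q.2
    ((hasDerivAt_const q.2 q.1).prodMk (hasDerivAt_id q.2))

theorem lieBracket_verticalField_liftL {f : R4 → ℝ} (hf : ContDiff ℝ ∞ f) (q : R4) :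
    VectorField.lieBracket ℝ verticalField (liftL f) q =
      ((deriv (fun τ : ℝ => f (q.1, τ)) q.2) •
        ((-Real.sin (f q), -Real.sin (f q) * q.1.2.2, Real.cos (f q)) : R3), (0 : ℝ)) := by
  have hL : HasDerivAt (fun τ : ℝ => liftL f (q.1, τ))
      (fderiv ℝ (liftL f) q ((0 : R3), (1 : ℝ))) q.2 :=
    (((contDiff_liftL hf).differentiable (by simp)) q).hasFDerivAt.comp_hasDerivAt
      (f := fun τ : ℝ => (q.1, τ)) q.2 ((hasDerivAt_const q.2 q.1).prodMk (hasDerivAt_id q.2))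
  have hg := (hasDerivAt_snd_param hf q).differentiableAt.hasDerivAt
  have hL' : HasDerivAt (fun τ : ℝ => liftL f (q.1, τ)) _ q.2 :=
    (hg.cos.prodMk ((hg.cos.mul_const q.1.2.2).prodMk hg.sin)).prodMk (hasDerivAt_const q.2 (0 : ℝ))
      |>.congr_of_eventuallyEq (.of_forall fun τ => by simp [liftL, legendrian_eq])
  have hv : fderiv ℝ verticalField q = 0 := by
    simp [Function.const_def, show verticalField = fun _ => ((0 : R3), (1 : ℝ)) from rfl]
  rw [VectorField.lieBracket, hv, verticalField, hL.unique hL']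
  ext <;> simp <;> ring

/-- `E = [D, D]` is spanned by `∂_t` and the contact planes: `[∂_t, L]` is independent of `L`
in `ξ` because `L` turns. -/
theorem derivedDistribution_turningPlane {f : R4 → ℝ} (hf : ContDiff ℝ ∞ f)
    (hturn : ∀ p t, 0 < deriv (fun τ : ℝ => f (p, τ)) t) :
    derivedDistribution (turningPlane f) = contactPreimage := by
  funext q
  apply le_antisymm
  · refine sup_le (turningPlane_le_contactPreimage f q) (Submodule.span_le.2 ?_)
    rintro _ ⟨V, W, hV, hW, rfl⟩
    have h := lieBracket_contactForm hV.of_turningPlane hW.of_turningPlane q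
    obtain ⟨a, ha⟩ := mem_turningPlane.1 (hV.2 q)
    obtain ⟨b, hb⟩ := mem_turningPlane.1 (hW.2 q)
    rw [ha, hb, legendrian_eq] at h
    simp only [Prod.smul_mk, smul_eq_mul] at h
    rw [SetLike.mem_coe, mem_contactPreimage]
    linarith
  · intro v hv
    rw [mem_contactPreimage] at hv
    set c := deriv (fun τ : ℝ => f (q.1, τ)) q.2 with hc
    have hc0 : c ≠ 0 := (hturn q.1 q.2).ne'
    set b := (-Real.sin (f q) * v.1.1 + Real.cos (f q) * v.1.2.2) / c with hb
    have hbr := lieBracket_verticalField_liftL hf q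
    rw [← hc] at hbr
    have hbc : b * c = -Real.sin (f q) * v.1.1 + Real.cos (f q) * v.1.2.2 := by
      rw [hb]; field_simp
    rw [derivedDistribution, Submodule.mem_sup]
    refine ⟨v - b • VectorField.lieBracket ℝ verticalField (liftL f) q, ?_,
      b • VectorField.lieBracket ℝ verticalField (liftL f) q,
      Submodule.smul_mem _ _ (Submodule.subset_span
        ⟨_, _, isSectionOf_verticalField f, isSectionOf_liftL hf, rfl⟩), by simp⟩
    refine mem_turningPlane.2 ⟨Real.cos (f q) * v.1.1 + Real.sin (f q) * v.1.2.2, ?_⟩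
    have hcs := Real.sin_sq_add_cos_sq (f q)
    rw [hbr, legendrian_eq]
    ext
    · simp
      linear_combination (Real.sin (f q)) * hbc - v.1.1 * hcs
    · simp
      linear_combination (Real.sin (f q) * q.1.2.2) * hbc + hv - q.1.2.2 * v.1.1 * hcs
    · simp
      linear_combination (-Real.cos (f q)) * hbc - v.1.2.2 * hcs

theorem lieBracket_liftX_liftZ (q : R4) :
    (VectorField.lieBracket ℝ liftX liftZ q).1.2.1 -
      q.1.2.2 * (VectorField.lieBracket ℝ liftX liftZ q).1.1 = -1 := by
  rw [lieBracket_contactForm isSectionOf_liftX isSectionOf_liftZ]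
  simp [liftX, liftZ, frameX, frameZ]

theorem derivedDistribution_contactPreimage (q : R4) :
    derivedDistribution contactPreimage q = ⊤ := by
  rw [eq_top_iff]
  intro v _
  have h := lieBracket_liftX_liftZ q
  set B := VectorField.lieBracket ℝ liftX liftZ q with hB
  set a := -(v.1.2.1 - q.1.2.2 * v.1.1) with ha
  rw [derivedDistribution, Submodule.mem_sup]
  refine ⟨v - a • B, ?_, a • B, Submodule.smul_mem _ _ (Submodule.subset_span
    ⟨_, _, isSectionOf_liftX, isSectionOf_liftZ, hB⟩), by simp⟩
  rw [mem_contactPreimage]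
  simp
  linear_combination (-a) * h - ha

theorem isSmoothDistribution_turningPlane {f : R4 → ℝ} (hf : ContDiff ℝ ∞ f) :
    IsSmoothDistribution 2 (turningPlane f) := by
  intro p
  refine ⟨univ, isOpen_univ, mem_univ _, ![verticalField, liftL f], ?_, ?_⟩
  · intro i
    fin_cases i
    · exact contDiff_const.contDiffOn
    · exact (contDiff_liftL hf).contDiffOn
  · intro q _
    have hfun : (fun i => (![verticalField, liftL f] : Fin 2 → R4 → R4) i q) =
        ![((0 : R3), (1 : ℝ)), (legendrian (f q) q.1, (0 : ℝ))] := by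
      funext i
      fin_cases i <;> rfl
    rw [hfun]
    constructor
    · rw [LinearIndependent.pair_iff]
      intro a b hab
      rw [legendrian_eq] at hab
      simp only [Prod.ext_iff] at hab
      simp at hab
      obtain ⟨⟨h1, -, h3⟩, h4⟩ := hab
      refine ⟨h4, ?_⟩
      have hcs := Real.sin_sq_add_cos_sq (f q)
      rcases h1 with h | h
      · exact h
      · rcases h3 with h' | h'
        · exact h'
        · rw [h, h'] at hcs
          norm_num at hcs
    · rw [Matrix.range_cons_cons_empty]
      rfl

theorem isSmoothDistribution_contactPreimage : IsSmoothDistribution 3 contactPreimage := by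
  intro p
  refine ⟨univ, isOpen_univ, mem_univ _, ![verticalField, liftX, liftZ], ?_, ?_⟩
  · intro i
    fin_cases i
    · exact contDiff_const.contDiffOn
    · exact contDiff_liftX.contDiffOn
    · exact contDiff_const.contDiffOn
  · intro q _
    constructor
    · rw [Fintype.linearIndependent_iff]
      intro g hg
      simp only [Fin.sum_univ_three, Prod.ext_iff] at hg
      simp [verticalField, liftX, liftZ, frameX, frameZ] at hg
      intro i
      fin_cases i <;> simp <;> tauto
    · apply le_antisymm
      · rw [Submodule.span_le]
        rintro _ ⟨i, rfl⟩
        fin_cases i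
        · simp [verticalField, mem_contactPreimage]
        · exact liftX_mem q
        · exact liftZ_mem q
      · intro v hv
        rw [mem_contactPreimage] at hv
        have : v = v.2 • verticalField q + v.1.1 • liftX q + v.1.2.2 • liftZ q := by
          ext <;> simp [verticalField, liftX, liftZ, frameX, frameZ, hv]
          ring
        rw [this]
        exact add_mem (add_mem (Submodule.smul_mem _ _ (Submodule.subset_span ⟨0, rfl⟩))
          (Submodule.smul_mem _ _ (Submodule.subset_span ⟨1, rfl⟩)))
          (Submodule.smul_mem _ _ (Submodule.subset_span ⟨2, rfl⟩))

theorem isEngel_turningPlane {f : R4 → ℝ} (hf : ContDiff ℝ ∞ f)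
    (hturn : ∀ p t, 0 < deriv (fun τ : ℝ => f (p, τ)) t) : IsEngel (turningPlane f) := by
  refine ⟨isSmoothDistribution_turningPlane hf, ?_⟩
  rw [derivedDistribution_turningPlane hf hturn]
  exact ⟨isSmoothDistribution_contactPreimage, derivedDistribution_contactPreimage⟩

/-- The kernel of the Engel structure is spanned by `∂_t`. -/
theorem mem_engelKernel {f : R4 → ℝ} (hf : ContDiff ℝ ∞ f)
    (hturn : ∀ p t, 0 < deriv (fun τ : ℝ => f (p, τ)) t) {q v : R4} :
    v ∈ engelKernel (turningPlane f) q ↔ v.1 = 0 := by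
  rw [engelKernel, derivedDistribution_turningPlane hf hturn]
  constructor
  · intro hv
    have hle : ({v | ∃ V : R4 → R4, IsSectionOf (turningPlane f) V ∧
        (∀ Y : R4 → R4, IsSectionOf contactPreimage Y →
          ∀ q, VectorField.lieBracket ℝ V Y q ∈ contactPreimage q) ∧ v = V q} : Set R4) ⊆
        LinearMap.ker (LinearMap.fst ℝ R3 ℝ) := by
      rintro _ ⟨V, hV, hbr, rfl⟩
      have h1 := lieBracket_contactForm hV.of_turningPlane isSectionOf_liftX q
      have h2 := lieBracket_contactForm hV.of_turningPlane isSectionOf_liftZ q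
      rw [mem_contactPreimage.1 (hbr _ isSectionOf_liftX q)] at h1
      rw [mem_contactPreimage.1 (hbr _ isSectionOf_liftZ q)] at h2
      have h3 := mem_contactPreimage.1 (hV.of_turningPlane.2 q)
      simp [liftX, frameX] at h1
      simp [liftZ, frameZ] at h2
      rw [h2] at h3
      simp only [SetLike.mem_coe, LinearMap.mem_ker, LinearMap.fst_apply]
      ext
      · exact h2
      · simpa using h3
      · exact h1.symm
    exact Submodule.span_le.2 hle hv
  · intro hv
    have : v = v.2 • ((0 : R3), (1 : ℝ)) := by
      ext1 <;> simp [hv]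
    rw [this]
    refine Submodule.smul_mem _ _ (Submodule.subset_span
      ⟨verticalField, isSectionOf_verticalField f, ?_, rfl⟩)
    intro Y hY q
    have h := lieBracket_contactForm (isSectionOf_verticalField f).of_turningPlane hY q
    simp only [show (verticalField q).1 = 0 from rfl, Prod.fst_zero, Prod.snd_zero] at h
    rw [mem_contactPreimage]
    linarith

/-! ### Inverse and implicit functions -/

theorem ContinuousLinearMap.exists_equiv_of_ker_eq_bot {E : Type*} [NormedAddCommGroup E]
    [NormedSpace ℝ E] [FiniteDimensional ℝ E] (A : E →L[ℝ] E) (hA : ∀ v, A v = 0 → v = 0) :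
    ∃ e : E ≃L[ℝ] E, (e : E →L[ℝ] E) = A := by
  have hinj : Function.Injective (A : E →ₗ[ℝ] E) :=
    (injective_iff_map_eq_zero (A : E →ₗ[ℝ] E)).2 hA
  refine ⟨(LinearEquiv.ofInjectiveEndo (A : E →ₗ[ℝ] E) hinj).toContinuousLinearEquiv, ?_⟩
  ext v
  simp

/-- The implicit function theorem along a line of parameters, with a solution that is smooth on a
whole neighbourhood of the base point. -/
theorem exists_implicit_curve {E : Type*} [NormedAddCommGroup E] [NormedSpace ℝ E]
    [FiniteDimensional ℝ E] {G : ℝ × E → E} (hG : ContDiff ℝ ∞ G) (hG0 : G 0 = 0)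
    (hinj : ∀ v, fderiv ℝ G 0 ((0 : ℝ), v) = 0 → v = 0) :
    ∃ κ : ℝ → E, κ 0 = 0 ∧ ∀ᶠ s in 𝓝 (0 : ℝ), ContDiffAt ℝ ∞ κ s ∧ G (s, κ s) = 0 := by
  have : CompleteSpace E := FiniteDimensional.complete ℝ E
  set Θ : ℝ × E → ℝ × E := fun q => (q.1, G q) with hΘ
  have hΘs : ContDiff ℝ ∞ Θ := contDiff_fst.prodMk hG
  have hΘd : ∀ q, HasFDerivAt Θ (fderiv ℝ Θ q) q := fun q =>
    ((hΘs.differentiable (by simp)) q).hasFDerivAt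
  obtain ⟨e', he'⟩ := (fderiv ℝ Θ 0).exists_equiv_of_ker_eq_bot (by
    intro v hv
    have h1 : HasFDerivAt Θ _ 0 := hasFDerivAt_fst.prodMk
      ((hG.differentiable (by simp)) 0).hasFDerivAt
    rw [h1.fderiv, ContinuousLinearMap.prod_apply, Prod.mk_eq_zero] at hv
    obtain ⟨hv1, hv2⟩ := hv
    have hv1' : v.1 = 0 := hv1
    have : v = ((0 : ℝ), v.2) := Prod.ext hv1' rfl
    rw [this] at hv2
    exact Prod.ext hv1' (hinj _ hv2))
  have hd0 : HasFDerivAt Θ (e' : ℝ × E →L[ℝ] ℝ × E) 0 := he' ▸ hΘd 0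
  set e := hΘs.contDiffAt.toOpenPartialHomeomorph Θ hd0 (by simp) with he
  have hcoe : ∀ q, e q = Θ q := fun q => rfl
  have h0s : (0 : ℝ × E) ∈ e.source :=
    hΘs.contDiffAt.mem_toOpenPartialHomeomorph_source hd0 (by simp)
  have hΘ0 : Θ 0 = 0 := by simp [hΘ, hG0]
  have h0t : (0 : ℝ × E) ∈ e.target := by
    have := e.map_source h0s
    rwa [hcoe, hΘ0] at this
  have hsymm0 : e.symm 0 = 0 := by
    have := e.left_inv h0s
    rwa [hcoe, hΘ0] at this
  have hline : Tendsto (fun s : ℝ => (s, (0 : E))) (𝓝 0) (𝓝 0) :=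
    (Continuous.prodMk_left (0 : E)).tendsto' _ _ rfl
  have hinv : ∀ᶠ q in 𝓝 (0 : ℝ × E), fderiv ℝ Θ q ∈
      range ((↑) : ((ℝ × E) ≃L[ℝ] (ℝ × E)) → (ℝ × E) →L[ℝ] (ℝ × E)) :=
    (hΘs.continuous_fderiv (by simp)).continuousAt.eventually_mem
      ((ContinuousLinearEquiv.isOpen (𝕜 := ℝ)).mem_nhds ⟨e', he'⟩)
  have hsymm : Tendsto (fun s : ℝ => e.symm (s, (0 : E))) (𝓝 0) (𝓝 0) := by
    have := (e.continuousAt_symm h0t).tendsto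
    rw [hsymm0] at this
    exact this.comp hline
  refine ⟨fun s => (e.symm (s, (0 : E))).2, ?_, ?_⟩
  · change (e.symm 0).2 = 0
    rw [hsymm0]
    rfl
  · filter_upwards [hsymm.eventually hinv, hline.eventually (e.open_target.mem_nhds h0t)]
      with s hs1 hs2
    obtain ⟨e₁, he₁⟩ := hs1
    have hd : HasFDerivAt e (e₁ : ℝ × E →L[ℝ] ℝ × E) (e.symm (s, (0 : E))) := he₁ ▸ hΘd _
    have hc : ContDiffAt ℝ ∞ e.symm (s, (0 : E)) := e.contDiffAt_symm hs2 hd hΘs.contDiffAt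
    refine ⟨(hc.comp s (contDiffAt_id.prodMk contDiffAt_const)).snd, ?_⟩
    have hr : Θ (e.symm (s, (0 : E))) = (s, 0) := e.right_inv hs2
    have h1 : (e.symm (s, (0 : E))).1 = s := congrArg Prod.fst hr
    have h2 : G (e.symm (s, (0 : E))) = 0 := congrArg Prod.snd hr
    have h3 : (s, (e.symm (s, (0 : E))).2) = e.symm (s, (0 : E)) := Prod.ext h1.symm rfl
    exact (congrArg G h3).trans h2

/-- As `f` increases with `t`, the time can be recovered smoothly from the point of `ℝ³` and the
angle: `σ (p, a)` is the time at which the angle over `p` is `a`. -/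
theorem exists_time_of_angle {f : R4 → ℝ} (hf : ContDiff ℝ ∞ f)
    (hturn : ∀ p t, 0 < deriv (fun τ : ℝ => f (p, τ)) t) :
    ∃ Ω : Set R4, IsOpen Ω ∧ ∃ σ : R4 → ℝ, (∀ w ∈ Ω, ContDiffAt ℝ ∞ σ w) ∧
      (∀ q : R4, (q.1, f q) ∈ Ω ∧ σ (q.1, f q) = q.2) ∧ ∀ w ∈ Ω, f (w.1, σ w) = w.2 := by
  set Ψ : R4 → R4 := fun q => (q.1, f q) with hΨ
  have hΨs : ContDiff ℝ ∞ Ψ := contDiff_fst.prodMk hf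
  have hinj : Function.Injective Ψ := by
    rintro ⟨p, t⟩ ⟨p', t'⟩ h
    simp only [hΨ, Prod.mk.injEq] at h
    obtain ⟨rfl, h⟩ := h
    rw [(strictMono_of_deriv_pos (hturn p)).injective h]
  have hloc : ∀ q, ∃ e : OpenPartialHomeomorph R4 R4, (∀ q, e q = Ψ q) ∧ Ψ q ∈ e.target ∧
      ContDiffAt ℝ ∞ e.symm (Ψ q) := by
    intro q
    have hd : HasFDerivAt Ψ (fderiv ℝ Ψ q) q := ((hΨs.differentiable (by simp)) q).hasFDerivAt
    obtain ⟨e', he'⟩ := (fderiv ℝ Ψ q).exists_equiv_of_ker_eq_bot (by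
      intro v hv
      have h1 : HasFDerivAt Ψ _ q := hasFDerivAt_fst.prodMk
        ((hf.differentiable (by simp)) q).hasFDerivAt
      rw [h1.fderiv, ContinuousLinearMap.prod_apply, Prod.mk_eq_zero] at hv
      obtain ⟨hv1, hv2⟩ := hv
      have hv1' : v.1 = 0 := hv1
      have hv' : v = v.2 • ((0 : R3), (1 : ℝ)) := by
        ext1 <;> simp [hv1']
      rw [hv', map_smul, ← (hasDerivAt_snd_param hf q).deriv, smul_eq_mul] at hv2
      exact Prod.ext hv1' ((mul_eq_zero.1 hv2).resolve_right (hturn q.1 q.2).ne'))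
    rw [← he'] at hd
    exact ⟨hΨs.contDiffAt.toOpenPartialHomeomorph Ψ hd (by simp), fun _ => rfl,
      hΨs.contDiffAt.image_mem_toOpenPartialHomeomorph_target hd (by simp),
      hΨs.contDiffAt.to_localInverse hd (by simp)⟩
  have hleft : ∀ q, Function.invFun Ψ (Ψ q) = q := Function.leftInverse_invFun hinj
  have hσ : ∀ w ∈ range Ψ, f (w.1, (Function.invFun Ψ w).2) = w.2 := by
    rintro _ ⟨q, rfl⟩
    rw [hleft]
  refine ⟨range Ψ, isOpen_iff_mem_nhds.2 ?_, fun w => (Function.invFun Ψ w).2, ?_,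
    fun q => ⟨mem_range_self q, congrArg Prod.snd (hleft q)⟩, hσ⟩
  · rintro _ ⟨q, rfl⟩
    obtain ⟨e, he, hq, -⟩ := hloc q
    filter_upwards [e.open_target.mem_nhds hq] with w hw
    exact ⟨e.symm w, by rw [← he, e.right_inv hw]⟩
  · rintro _ ⟨q, rfl⟩
    obtain ⟨e, he, hq, hs⟩ := hloc q
    refine (hs.congr_of_eventuallyEq ?_).snd
    filter_upwards [e.open_target.mem_nhds hq] with w hw
    apply hinj
    rw [← he (e.symm w), e.right_inv hw]
    exact Function.invFun_eq ⟨e.symm w, by rw [← he, e.right_inv hw]⟩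

/-! ### Legendrian arcs with prescribed angle -/

/-- The primitive of `h` vanishing at `0`. -/
noncomputable def primitive (h : ℝ → ℝ) (θ : ℝ) : ℝ := ∫ t in (0 : ℝ)..θ, h t

theorem primitive_zero (h : ℝ → ℝ) : primitive h 0 = 0 := intervalIntegral.integral_same

theorem hasDerivAt_primitive {h : ℝ → ℝ} (hh : Continuous h) (θ : ℝ) :
    HasDerivAt (primitive h) (h θ) θ :=
  hh.integral_hasStrictDerivAt 0 θ |>.hasDerivAt

theorem contDiff_primitive {h : ℝ → ℝ} (hh : ContDiff ℝ ∞ h) : ContDiff ℝ ∞ (primitive h) := by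
  rw [contDiff_infty_iff_deriv]
  refine ⟨fun θ => (hasDerivAt_primitive hh.continuous θ).differentiableAt, ?_⟩
  rwa [funext fun θ => (hasDerivAt_primitive hh.continuous θ).deriv]

section Arc

variable (g : ℝ → ℝ) (u : Fin 3 → ℝ → ℝ)

/-- The Legendrian arc in `ℝ³` which starts at `(0, y, 0)` and has velocity `c L`, where `L` is the
Legendrian vector of angle `g` and `c = ∑ kᵢ uᵢ`. As `g` is prescribed independently of the arc, the
arc is given by integrals, and depends polynomially on `k` and `y`. -/
noncomputable def legendrianArc (k : Fin 3 → ℝ) (y θ : ℝ) : R3 :=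
  (∑ i, k i * primitive (fun t => u i t * Real.cos (g t)) θ,
    y + ∑ i, ∑ j, k i * k j * primitive (fun t => primitive (fun t => u i t * Real.sin (g t)) t *
      (u j t * Real.cos (g t))) θ,
    ∑ i, k i * primitive (fun t => u i t * Real.sin (g t)) θ)

theorem legendrianArc_zero (k : Fin 3 → ℝ) (y : ℝ) : legendrianArc g u k y 0 = (0, y, 0) := by
  simp [legendrianArc, primitive_zero]

theorem legendrianArc_zero_zero (θ : ℝ) : legendrianArc g u 0 0 θ = 0 := by
  simp [legendrianArc]

variable {g u}

theorem contDiff_legendrianArc (hg : ContDiff ℝ ∞ g) (hu : ∀ i, ContDiff ℝ ∞ (u i)) :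
    ContDiff ℝ ∞ fun q : (Fin 3 → ℝ) × ℝ × ℝ => legendrianArc g u q.1 q.2.1 q.2.2 := by
  have h1 : ∀ i, ContDiff ℝ ∞ (primitive fun t => u i t * Real.cos (g t)) := fun i =>
    contDiff_primitive ((hu i).mul hg.cos)
  have h2 : ∀ i, ContDiff ℝ ∞ (primitive fun t => u i t * Real.sin (g t)) := fun i =>
    contDiff_primitive ((hu i).mul hg.sin)
  have h3 : ∀ i j, ContDiff ℝ ∞ (primitive fun t =>
      primitive (fun t => u i t * Real.sin (g t)) t * (u j t * Real.cos (g t))) := fun i j =>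
    contDiff_primitive ((h2 i).mul ((hu j).mul hg.cos))
  unfold legendrianArc
  fun_prop

theorem hasDerivAt_legendrianArc (hg : ContDiff ℝ ∞ g) (hu : ∀ i, ContDiff ℝ ∞ (u i))
    (k : Fin 3 → ℝ) (y θ : ℝ) :
    HasDerivAt (legendrianArc g u k y)
      ((∑ i, k i * u i θ) • legendrian (g θ) (legendrianArc g u k y θ)) θ := by
  have h1 : ∀ i, HasDerivAt (fun θ => k i * primitive (fun t => u i t * Real.cos (g t)) θ)
      (k i * (u i θ * Real.cos (g θ))) θ := fun i =>
    (hasDerivAt_primitive ((hu i).mul hg.cos).continuous θ).const_mul (k i)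
  have h2 : ∀ i, HasDerivAt (fun θ => k i * primitive (fun t => u i t * Real.sin (g t)) θ)
      (k i * (u i θ * Real.sin (g θ))) θ := fun i =>
    (hasDerivAt_primitive ((hu i).mul hg.sin).continuous θ).const_mul (k i)
  have h3 : ∀ i j, HasDerivAt (fun θ => k i * k j * primitive (fun t =>
      primitive (fun t => u i t * Real.sin (g t)) t * (u j t * Real.cos (g t))) θ)
      (k i * k j * (primitive (fun t => u i t * Real.sin (g t)) θ *
        (u j θ * Real.cos (g θ)))) θ := fun i j =>
    (hasDerivAt_primitive ((contDiff_primitive ((hu i).mul hg.sin)).mul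
      ((hu j).mul hg.cos)).continuous θ).const_mul (k i * k j)
  have H := (HasDerivAt.fun_sum (u := Finset.univ) fun i _ => h1 i).prodMk
    (((HasDerivAt.fun_sum (u := Finset.univ) fun i _ =>
      HasDerivAt.fun_sum (u := Finset.univ) fun j _ => h3 i j).const_add y).prodMk
      (HasDerivAt.fun_sum (u := Finset.univ) fun i _ => h2 i))
  refine H.congr_deriv ?_
  rw [legendrian_eq]
  simp only [legendrianArc, Fin.sum_univ_three, Prod.smul_mk, smul_eq_mul, Prod.mk.injEq]
  exact ⟨by ring, by ring, by ring⟩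

end Arc

/-- The vectors `∫ w cos g (cos g, sin g)` and `∫ w sin g (cos g, sin g)` of `ℝ²` are linearly
independent: they form the Gram matrix of `cos g` and `sin g` in `L²(w)`, and no nontrivial
combination of these two functions vanishes near a point where `w > 0` and `g' ≠ 0`. -/
theorem turning_directions_independent {g w : ℝ → ℝ} (hg : ContDiff ℝ ∞ g) (hw : ContDiff ℝ ∞ w)
    (hw0 : ∀ t, 0 ≤ w t) {θ₀ : ℝ} (hθ₀ : θ₀ ∈ Ioo (0 : ℝ) 1) (hw1 : 0 < w θ₀)
    (hg' : deriv g θ₀ ≠ 0) {a b : ℝ}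
    (h1 : a * primitive (fun t => w t * Real.cos (g t) * Real.cos (g t)) 1 +
      b * primitive (fun t => w t * Real.sin (g t) * Real.cos (g t)) 1 = 0)
    (h2 : a * primitive (fun t => w t * Real.cos (g t) * Real.sin (g t)) 1 +
      b * primitive (fun t => w t * Real.sin (g t) * Real.sin (g t)) 1 = 0) :
    a = 0 ∧ b = 0 := by
  set F : ℝ → ℝ := fun t => a * Real.cos (g t) + b * Real.sin (g t) with hF
  have hFs : ContDiff ℝ ∞ F := (contDiff_const.mul hg.cos).add (contDiff_const.mul hg.sin)
  have hc : Continuous fun t => w t * F t ^ 2 := (hw.continuous).mul (hFs.continuous.pow 2)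
  have hwc := hw.continuous
  have hgc := hg.continuous
  have hint : ∫ t in (0 : ℝ)..1, w t * F t ^ 2 = 0 := by
    have e : (fun t => w t * F t ^ 2) = fun t =>
        a * (a * (w t * Real.cos (g t) * Real.cos (g t)) +
          b * (w t * Real.sin (g t) * Real.cos (g t))) +
        b * (a * (w t * Real.cos (g t) * Real.sin (g t)) +
          b * (w t * Real.sin (g t) * Real.sin (g t))) := by
      funext t
      simp only [hF]
      ring
    have hi : ∀ {h : ℝ → ℝ}, Continuous h → IntervalIntegrable h MeasureTheory.volume 0 1 :=
      fun h => h.intervalIntegrable 0 1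
    rw [e, intervalIntegral.integral_add (hi (by fun_prop)) (hi (by fun_prop)),
      intervalIntegral.integral_const_mul, intervalIntegral.integral_const_mul,
      intervalIntegral.integral_add (hi (by fun_prop)) (hi (by fun_prop)),
      intervalIntegral.integral_add (hi (by fun_prop)) (hi (by fun_prop))]
    simp only [intervalIntegral.integral_const_mul]
    simp only [primitive] at h1 h2
    rw [h1, h2]
    ring
  have hzero : ∀ t ∈ Ioo (0 : ℝ) 1, w t * F t ^ 2 = 0 := by
    by_contra! hne
    obtain ⟨t, ht, hne⟩ := hne
    refine hint.not_gt (intervalIntegral.integral_pos zero_lt_one hc.continuousOn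
      (fun t _ => mul_nonneg (hw0 t) (sq_nonneg _)) ⟨t, Ioo_subset_Icc_self ht, ?_⟩)
    exact lt_of_le_of_ne (mul_nonneg (hw0 t) (sq_nonneg _)) hne.symm
  have hev : F =ᶠ[𝓝 θ₀] fun _ => 0 := by
    filter_upwards [isOpen_Ioo.mem_nhds hθ₀,
      hwc.continuousAt.eventually (lt_mem_nhds hw1)] with t ht hwt
    simpa [hwt.ne'] using hzero t ht
  have hd : HasDerivAt F (a * (-Real.sin (g θ₀) * deriv g θ₀) + b * (Real.cos (g θ₀) * deriv g θ₀))
      θ₀ := by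
    have hgd := ((hg.differentiable (by simp)) θ₀).hasDerivAt
    exact (hgd.cos.const_mul a).add (hgd.sin.const_mul b)
  have e1 : a * Real.cos (g θ₀) + b * Real.sin (g θ₀) = 0 := hev.self_of_nhds
  have e2 : -a * Real.sin (g θ₀) + b * Real.cos (g θ₀) = 0 := by
    have := hd.unique ((hasDerivAt_const θ₀ (0 : ℝ)).congr_of_eventuallyEq hev)
    have h' : (-a * Real.sin (g θ₀) + b * Real.cos (g θ₀)) * deriv g θ₀ = 0 := by linarith
    exact (mul_eq_zero.1 h').resolve_right hg'
  have hcs := Real.sin_sq_add_cos_sq (g θ₀)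
  exact ⟨by linear_combination Real.cos (g θ₀) * e1 - Real.sin (g θ₀) * e2 - a * hcs,
    by linear_combination Real.sin (g θ₀) * e1 + Real.cos (g θ₀) * e2 - b * hcs⟩

/-- If a diffeomorphism `φ` of `ℝ³` fixes the origin and multiplies `dy` by `lam ≠ 1` there, small
Legendrian arcs with prescribed angle function `g` can be closed up to the monodromy `φ`. -/
theorem exists_closed_arcs {g : ℝ → ℝ} (hg : ContDiff ℝ ∞ g) (hg' : deriv g (1 / 2) ≠ 0)
    {φ : R3 ≃ R3} (hφ : ContDiff ℝ ∞ φ) (hφ' : ContDiff ℝ ∞ φ.symm) (h0 : φ 0 = 0)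
    {lam : ℝ} (hlam : ∀ v, (fderiv ℝ φ 0 v).2.1 = lam * v.2.1) (hlam1 : lam ≠ 1) :
    ∃ (P : ℝ × ℝ → R3) (c : ℝ → ℝ → ℝ), (∀ θ, P (0, θ) = 0) ∧ ∀ᶠ s in 𝓝 (0 : ℝ),
      (∀ θ, ContDiffAt ℝ ∞ P (s, θ)) ∧
      (∀ θ, HasDerivAt (fun θ => P (s, θ)) (c s θ • legendrian (g θ) (P (s, θ))) θ) ∧
      (∀ θ, θ ∉ Ioo (3 / 8 : ℝ) (7 / 8) → c s θ = 0) ∧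
      φ (P (s, 1)) = P (s, 0) ∧ (s ≠ 0 → c s (3 / 4) ≠ 0) := by
  -- The supports `(3/8, 5/8)` of `w` and `(5/8, 7/8)` of `u₀` are disjoint.
  let w : ContDiffBump (1 / 2 : ℝ) := ⟨1 / 16, 1 / 8, by norm_num, by norm_num⟩
  let u₀ : ContDiffBump (3 / 4 : ℝ) := ⟨1 / 16, 1 / 8, by norm_num, by norm_num⟩
  let u : Fin 3 → ℝ → ℝ := ![u₀, fun t => w t * Real.cos (g t), fun t => w t * Real.sin (g t)]
  have hws : ContDiff ℝ ∞ w := w.contDiff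
  have hu : ∀ i, ContDiff ℝ ∞ (u i) := by
    intro i
    fin_cases i
    · exact u₀.contDiff
    · exact hws.mul hg.cos
    · exact hws.mul hg.sin
  have hwz : ∀ t : ℝ, t ∉ Ioo (3 / 8 : ℝ) (5 / 8) → w t = 0 := by
    intro t ht
    apply w.zero_of_le_dist
    by_contra! h
    rw [Real.dist_eq, abs_lt] at h
    change _ < _ - _ ∧ _ < (1 / 8 : ℝ) at h
    have h' : -(1 / 8 : ℝ) < t - 1 / 2 := h.1
    exact ht ⟨by linarith, by linarith [h.2]⟩
  have huz : ∀ t : ℝ, t ∉ Ioo (5 / 8 : ℝ) (7 / 8) → u₀ t = 0 := by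
    intro t ht
    apply u₀.zero_of_le_dist
    by_contra! h
    rw [Real.dist_eq, abs_lt] at h
    have h' : -(1 / 8 : ℝ) < t - 3 / 4 := h.1
    have h'' : t - 3 / 4 < (1 / 8 : ℝ) := h.2
    exact ht ⟨by linarith, by linarith⟩
  have hu1 : u₀ (3 / 4) = 1 := u₀.one_of_mem_closedBall (Metric.mem_closedBall_self (by norm_num))
  -- The unknowns are `v = (a, y, b)`; the parameter `s` is the coefficient of the bump `u₀`.
  let K : ℝ × R3 → Fin 3 → ℝ := fun q => ![q.1, q.2.1, q.2.2.2]
  have hK : ContDiff ℝ ∞ K := by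
    rw [contDiff_pi]
    intro i
    fin_cases i <;> simp [K] <;> fun_prop
  let Q : ℝ × R3 → R3 := fun q => legendrianArc g u (K q) q.2.2.1 1
  let N : R3 →L[ℝ] R3 := (0 : R3 →L[ℝ] ℝ).prod
    (((ContinuousLinearMap.fst ℝ ℝ ℝ).comp (ContinuousLinearMap.snd ℝ ℝ (ℝ × ℝ))).prod 0)
  have hN : ∀ v, N v = (0, v.2.1, 0) := fun v => rfl
  let G : ℝ × R3 → R3 := fun q => Q q - φ.symm (N q.2)
  have hQ : ContDiff ℝ ∞ Q := (contDiff_legendrianArc hg hu).comp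
    (hK.prodMk ((by fun_prop : ContDiff ℝ ∞ fun q : ℝ × R3 => (q.2.2.1, (1 : ℝ)))))
  have hG : ContDiff ℝ ∞ G := hQ.sub (hφ'.comp (N.contDiff.comp contDiff_snd))
  have h0' : φ.symm 0 = 0 := by rw [Equiv.symm_apply_eq, h0]
  have hG0 : G 0 = 0 := by
    have hK0 : K 0 = 0 := by
      funext i
      fin_cases i <;> rfl
    simp only [G, Q, hK0]
    simp [legendrianArc_zero_zero, h0']
  have hinj : ∀ v, fderiv ℝ G 0 ((0 : ℝ), v) = 0 → v = 0 := by
    intro v hv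
    set A : ℝ := v.1 * primitive (fun t => w t * Real.cos (g t) * Real.cos (g t)) 1 +
      v.2.2 * primitive (fun t => w t * Real.sin (g t) * Real.cos (g t)) 1 with hA
    set C : ℝ := v.1 * primitive (fun t => w t * Real.cos (g t) * Real.sin (g t)) 1 +
      v.2.2 * primitive (fun t => w t * Real.sin (g t) * Real.sin (g t)) 1 with hC
    -- Along the line spanned by `v`, the arc has an affine and a quadratic part.
    have hline : HasDerivAt (fun r : ℝ => Q (r • ((0 : ℝ), v))) (A, v.2.1, C) 0 := by
      have hr := hasDerivAt_id (0 : ℝ)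
      set B : ℝ := ∑ i, ∑ j, K (0, v) i * K (0, v) j * primitive (fun t =>
        primitive (fun t => u i t * Real.sin (g t)) t * (u j t * Real.cos (g t))) 1 with hB
      have hQ' : (fun r : ℝ => Q (r • ((0 : ℝ), v))) =
          fun r : ℝ => (r * A, r * v.2.1 + r ^ 2 * B, r * C) := by
        funext r
        have hKr : ∀ i, K (r • ((0 : ℝ), v)) i = r * K (0, v) i := by
          intro i
          fin_cases i <;> simp [K]
        simp only [Q, legendrianArc, hKr, hA, hC, hB, Fin.sum_univ_three]
        simp [K, u]
        refine ⟨by ring, by ring, by ring⟩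
      rw [hQ']
      refine ((hr.mul_const A).prodMk (((hr.mul_const v.2.1).add
        ((hr.pow 2).mul_const B)).prodMk (hr.mul_const C))).congr_deriv ?_
      simp
    have hpsi : HasDerivAt (fun r : ℝ => φ.symm (N (r • v))) (fderiv ℝ φ.symm 0 (N v)) 0 := by
      have h1 : HasDerivAt (fun r : ℝ => N (r • v)) (N v) 0 := by
        have hr : HasDerivAt (fun r : ℝ => r • v) v 0 := by
          simpa using (hasDerivAt_id (0 : ℝ)).smul_const v
        exact N.hasFDerivAt.comp_hasDerivAt (0 : ℝ) hr
      have h2 := ((hφ'.differentiable (by simp)) 0).hasFDerivAt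
      have h3 : N ((0 : ℝ) • v) = 0 := by simp
      rw [← h3] at h2 ⊢
      exact h2.comp_hasDerivAt (0 : ℝ) h1
    have hGline : HasDerivAt (fun r : ℝ => G (r • ((0 : ℝ), v))) (fderiv ℝ G 0 ((0 : ℝ), v)) 0 := by
      have h1 : HasDerivAt (fun r : ℝ => r • ((0 : ℝ), v)) ((0 : ℝ), v) 0 := by
        simpa using (hasDerivAt_id (0 : ℝ)).smul_const ((0 : ℝ), v)
      have h2 := ((hG.differentiable (by simp)) 0).hasFDerivAt
      have h3 : (0 : ℝ) • ((0 : ℝ), v) = 0 := zero_smul _ _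
      rw [← h3] at h2 ⊢
      exact h2.comp_hasDerivAt (0 : ℝ) h1
    have hval := hGline.unique (hline.sub hpsi)
    rw [hv] at hval
    set m := fderiv ℝ φ.symm 0 (N v) with hm
    have hm' : fderiv ℝ φ 0 m = N v := by
      have h1 := ((hφ.differentiable (by simp)) (φ.symm 0)).hasFDerivAt.comp (0 : R3)
        ((hφ'.differentiable (by simp)) 0).hasFDerivAt
      have h2 : (φ ∘ φ.symm : R3 → R3) = id := funext fun p => φ.apply_symm_apply p
      rw [h2, h0'] at h1
      exact (DFunLike.congr_fun (h1.unique (hasFDerivAt_id (0 : R3))) (N v))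
    have hAm : A = m.1 := by
      have := congrArg (fun z : R3 => z.1) hval
      simp at this
      linarith
    have hym : v.2.1 = m.2.1 := by
      have := congrArg (fun z : R3 => z.2.1) hval
      simp at this
      linarith
    have hCm : C = m.2.2 := by
      have := congrArg (fun z : R3 => z.2.2) hval
      simp at this
      linarith
    have hy : v.2.1 = 0 := by
      have := hlam m
      rw [hm', hN, ← hym] at this
      have h' : (1 - lam) * v.2.1 = 0 := by
        simp at this
        linarith
      exact (mul_eq_zero.1 h').resolve_left (sub_ne_zero.2 hlam1.symm)
    have hm0 : m = 0 := by
      rw [hm, hN, hy]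
      exact map_zero _
    rw [hm0] at hAm hCm
    obtain ⟨ha, hb⟩ := turning_directions_independent hg hws (fun t => w.nonneg)
      (θ₀ := 1 / 2) (by norm_num)
      (by rw [w.one_of_mem_closedBall (Metric.mem_closedBall_self (by norm_num))]; norm_num)
      hg' hAm hCm
    exact Prod.ext ha (Prod.ext hy hb)
  obtain ⟨κ, hκ0, hκ⟩ := exists_implicit_curve hG hG0 hinj
  refine ⟨fun q => legendrianArc g u (K (q.1, κ q.1)) (κ q.1).2.1 q.2,
    fun s θ => ∑ i, K (s, κ s) i * u i θ, ?_, ?_⟩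
  · intro θ
    have hK0 : K (0, 0) = 0 := by
      funext i
      fin_cases i <;> rfl
    simp only [hκ0, hK0]
    exact legendrianArc_zero_zero g u θ
  · filter_upwards [hκ] with s hs
    refine ⟨fun θ => ?_, fun θ => hasDerivAt_legendrianArc hg hu _ _ θ, fun θ hθ => ?_, ?_, ?_⟩
    · have hκs : ContDiffAt ℝ ∞ (fun q : ℝ × ℝ => κ q.1) (s, θ) :=
        hs.1.comp (s, θ) contDiffAt_fst
      exact (contDiff_legendrianArc hg hu).contDiffAt.comp (s, θ)
        ((hK.contDiffAt.comp (s, θ) (contDiffAt_fst.prodMk hκs)).prodMk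
          (hκs.snd.fst.prodMk contDiffAt_snd))
    · have h1 : w θ = 0 := hwz θ fun h => hθ ⟨h.1, h.2.trans (by norm_num)⟩
      have h2 : u₀ θ = 0 := huz θ fun h => hθ ⟨lt_trans (by norm_num) h.1, h.2⟩
      simp [Fin.sum_univ_three, u, h1, h2]
    · have h1 : Q (s, κ s) = φ.symm (N (κ s)) := sub_eq_zero.1 hs.2
      change φ (Q (s, κ s)) = _
      rw [h1, φ.apply_symm_apply, legendrianArc_zero, hN]
    · intro hs0
      have h1 : w (3 / 4) = 0 := hwz _ fun h => by norm_num at h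
      simpa [Fin.sum_univ_three, u, h1, hu1, K] using hs0

/-! ### Horizontal arcs -/

theorem eq_of_hasDerivAt_smul {P : ℝ → R3} {c : ℝ → ℝ} {L : ℝ → R3} {I : Set ℝ}
    (hI : Convex ℝ I) (hP : ∀ θ, HasDerivAt P (c θ • L θ) θ) (hc : ∀ θ ∈ I, c θ = 0) {x y : ℝ}
    (hx : x ∈ I) (hy : y ∈ I) : P x = P y := by
  have h := hI.norm_image_sub_le_of_norm_hasDerivWithin_le (C := 0)
    (fun θ _ => (hP θ).hasDerivWithinAt) (fun θ hθ => by simp [hc θ hθ]) hy hx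
  rw [zero_mul, norm_le_zero_iff, sub_eq_zero] at h
  exact h

/-- Horizontal curves in `ℝ³ × ℝ` over `θ ∈ [0, 1]` which close up in the mapping torus, vary
smoothly with `s`, have `t' > 0`, and are not tangent to `∂_t` at `θ = 3 / 4` if `s ≠ 0`. -/
theorem exists_horizontal_arcs {φ : R3 ≃ R3} (hφ : ContDiff ℝ ∞ φ) (hφ' : ContDiff ℝ ∞ φ.symm)
    (h0 : φ 0 = 0) {lam : ℝ} (hlam : ∀ v, (fderiv ℝ φ 0 v).2.1 = lam * v.2.1) (hlam1 : lam ≠ 1)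
    {f : R4 → ℝ} (hf : ContDiff ℝ ∞ f)
    (hturn : ∀ p t, 0 < deriv (fun τ : ℝ => f (p, τ)) t) :
    ∃ H : ℝ × ℝ → R4, (∀ θ, H (0, θ) = ((0 : R3), θ)) ∧ ∀ᶠ s in 𝓝 (0 : ℝ),
      (∀ θ, ContDiffAt ℝ ∞ H (s, θ)) ∧
      (∀ θ, deriv (fun θ => H (s, θ)) θ ∈ turningPlane f (H (s, θ))) ∧
      (∀ θ, 0 < (deriv (fun θ => H (s, θ)) θ).2) ∧
      (∃ p, (∀ θ < (1 / 4 : ℝ), H (s, θ) = (p, θ)) ∧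
        ∀ θ > (15 / 16 : ℝ), H (s, θ) = (φ.symm p, θ)) ∧
      (s ≠ 0 → (deriv (fun θ => H (s, θ)) (3 / 4)).1 ≠ 0) := by
  obtain ⟨Ω, hΩ, σ, hσ, hσ1, hσ2⟩ := exists_time_of_angle hf hturn
  set g : ℝ → ℝ := fun θ => f ((0 : R3), θ) with hg
  have hgs : ContDiff ℝ ∞ g := hf.comp (contDiff_const.prodMk contDiff_id)
  obtain ⟨P, c, hP0, hP⟩ := exists_closed_arcs hgs (hturn 0 _).ne' hφ hφ' h0 hlam hlam1
  let χ : ContDiffBump (5 / 8 : ℝ) := ⟨1 / 4, 5 / 16, by norm_num, by norm_num⟩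
  have hχ1 : ∀ θ ∈ Icc (3 / 8 : ℝ) (7 / 8), χ θ = 1 := by
    intro θ hθ
    apply χ.one_of_mem_closedBall
    rw [Metric.mem_closedBall, Real.dist_eq, abs_le]
    change -(1 / 4 : ℝ) ≤ _ ∧ _ ≤ (1 / 4 : ℝ)
    exact ⟨by linarith [hθ.1], by linarith [hθ.2]⟩
  set J : Set ℝ := Icc (5 / 16 : ℝ) (15 / 16) with hJ
  have hχ0 : ∀ θ ∉ J, χ θ = 0 := by
    intro θ hθ
    apply χ.zero_of_le_dist
    by_contra! h
    rw [Real.dist_eq, abs_lt] at h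
    have h' : -(5 / 16 : ℝ) < θ - 5 / 8 := h.1
    have h'' : θ - 5 / 8 < (5 / 16 : ℝ) := h.2
    exact hθ ⟨by linarith, by linarith⟩
  have hJo : ∀ θ ∉ J, ∀ᶠ θ' in 𝓝 θ, θ' ∉ J := fun θ hθ =>
    isClosed_Icc.isOpen_compl.mem_nhds hθ
  have hσ0 : ∀ θ, ((0 : R3), g θ) ∈ Ω ∧ σ ((0 : R3), g θ) = θ := fun θ => hσ1 ((0 : R3), θ)
  -- Where the arc moves, the time is forced by the angle; elsewhere it is free, and it is
  -- interpolated to `t = θ` near the ends.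
  set T : ℝ × ℝ → ℝ := fun q => q.2 + χ q.2 * (σ (P q, g q.2) - q.2) with hT
  have hT0 : ∀ θ, T (0, θ) = θ := by
    intro θ
    simp [hT, hP0, (hσ0 θ).2]
  have hTJ : ∀ s, ∀ θ ∉ J, T (s, θ) = θ := by
    intro s θ hθ
    simp [hT, hχ0 θ hθ]
  have hΩev : ∀ᶠ s in 𝓝 (0 : ℝ), ∀ θ ∈ J, (P (s, θ), g θ) ∈ Ω := by
    apply isCompact_Icc.eventually_forall_of_forall_eventually
    intro θ _
    have hc : ContinuousAt (fun q : ℝ × ℝ => (P q, g q.2)) (0, θ) :=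
      (hP.self_of_nhds.1 θ).continuousAt.prodMk (hgs.continuous.comp continuous_snd).continuousAt
    refine hc.eventually (hΩ.mem_nhds ?_)
    simpa [hP0] using (hσ0 θ).1
  have hTs : ∀ᶠ s in 𝓝 (0 : ℝ), ∀ θ, ContDiffAt ℝ ∞ T (s, θ) := by
    filter_upwards [hP, hΩev] with s hs hs'
    intro θ
    by_cases hθ : θ ∈ J
    · have h1 : ContDiffAt ℝ ∞ (fun q : ℝ × ℝ => σ (P q, g q.2)) (s, θ) :=
        (hσ _ (hs' θ hθ)).comp (s, θ) ((hs.1 θ).prodMk (hgs.contDiffAt.comp (s, θ) contDiffAt_snd))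
      exact contDiffAt_snd.add ((χ.contDiff.contDiffAt.comp (s, θ) contDiffAt_snd).mul
        (h1.sub contDiffAt_snd))
    · refine contDiffAt_snd.congr_of_eventuallyEq ?_
      filter_upwards [continuousAt_snd.eventually (hJo θ hθ)] with q hq
      exact hTJ q.1 q.2 hq
  have hslice : ∀ s θ : ℝ, HasDerivAt (fun θ : ℝ => (s, θ)) ((0 : ℝ), (1 : ℝ)) θ := fun s θ =>
    (hasDerivAt_const θ s).prodMk (hasDerivAt_id θ)
  have hTd : ∀ᶠ s in 𝓝 (0 : ℝ), ∀ θ,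
      HasDerivAt (fun θ => T (s, θ)) (fderiv ℝ T (s, θ) ((0 : ℝ), (1 : ℝ))) θ := by
    filter_upwards [hTs] with s hs θ
    exact ((hs θ).differentiableAt (by simp)).hasFDerivAt.comp_hasDerivAt θ (hslice s θ)
  have hTpos : ∀ᶠ s in 𝓝 (0 : ℝ), ∀ θ, 0 < fderiv ℝ T (s, θ) ((0 : ℝ), (1 : ℝ)) := by
    have hpos : ∀ᶠ s in 𝓝 (0 : ℝ), ∀ θ ∈ J, 0 < fderiv ℝ T (s, θ) ((0 : ℝ), (1 : ℝ)) := by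
      apply isCompact_Icc.eventually_forall_of_forall_eventually
      intro θ _
      have hc : ContinuousAt (fun q : ℝ × ℝ => fderiv ℝ T q ((0 : ℝ), (1 : ℝ))) (0, θ) :=
        ((hTs.self_of_nhds θ).fderiv_right (m := 0) (by simp)).continuousAt.clm_apply
          continuousAt_const
      refine hc.eventually (lt_mem_nhds ?_)
      have h1 := hTd.self_of_nhds θ
      simp only [hT0] at h1
      change 0 < fderiv ℝ T (0, θ) ((0 : ℝ), (1 : ℝ))
      rw [h1.unique (hasDerivAt_id θ)]
      exact zero_lt_one
    filter_upwards [hpos, hTd] with s hs hs' θ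
    by_cases hθ : θ ∈ J
    · exact hs θ hθ
    · have h1 : (fun θ => T (s, θ)) =ᶠ[𝓝 θ] id := by
        filter_upwards [hJo θ hθ] with θ' hθ'
        exact hTJ s θ' hθ'
      rw [(hs' θ).unique ((hasDerivAt_id θ).congr_of_eventuallyEq h1)]
      exact zero_lt_one
  refine ⟨fun q => (P q, T q), fun θ => Prod.ext (hP0 θ) (hT0 θ), ?_⟩
  filter_upwards [hP, hΩev, hTs, hTd, hTpos] with s ⟨hPs, hPd, hcz, hPφ, hc1⟩ hΩs hTs hTd hTpos
  have hd : ∀ θ, deriv (fun θ => ((P (s, θ), T (s, θ)) : R4)) θ = _ := fun θ =>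
    ((hPd θ).prodMk (hTd θ)).deriv
  refine ⟨fun θ => (hPs θ).prodMk (hTs θ), fun θ => ?_, fun θ => ?_, ⟨P (s, 0), ?_, ?_⟩, ?_⟩
  · rw [hd, mem_turningPlane]
    by_cases hθ : θ ∈ Ioo (3 / 8 : ℝ) (7 / 8)
    · refine ⟨c s θ, ?_⟩
      have hχθ : χ θ = 1 := hχ1 θ ⟨hθ.1.le, hθ.2.le⟩
      have hTθ : T (s, θ) = σ (P (s, θ), g θ) := by
        simp [hT, hχθ]
      have hfθ : f (P (s, θ), T (s, θ)) = g θ := by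
        rw [hTθ]
        exact hσ2 _ (hΩs θ ⟨le_trans (by norm_num) hθ.1.le, hθ.2.le.trans (by norm_num)⟩)
      rw [hfθ]
    · exact ⟨0, by simp [hcz θ hθ]⟩
  · rw [hd]
    exact hTpos θ
  · intro θ hθ
    rw [hTJ s θ fun h => by linarith [h.1]]
    rw [eq_of_hasDerivAt_smul (convex_Iio (1 / 4 : ℝ)) hPd (fun θ' hθ' => hcz θ' fun h => by
      linarith [h.1, mem_Iio.1 hθ']) hθ (by norm_num : (0 : ℝ) ∈ Iio (1 / 4 : ℝ))]
  · intro θ hθ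
    rw [hTJ s θ fun h => by linarith [h.2]]
    rw [eq_of_hasDerivAt_smul (convex_Ioi (15 / 16 : ℝ)) hPd (fun θ' hθ' => hcz θ' fun h => by
      linarith [h.2, mem_Ioi.1 hθ']) hθ (by norm_num : (1 : ℝ) ∈ Ioi (15 / 16 : ℝ)),
      ← hPφ, φ.symm_apply_apply]
  · intro hs0 h
    rw [hd, legendrian_eq] at h
    have hc := hc1 hs0
    simp only [Prod.smul_mk, smul_eq_mul, Prod.mk_eq_zero, mul_eq_zero, hc, false_or] at h
    have hcs := Real.sin_sq_add_cos_sq (g (3 / 4))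
    rw [h.1, h.2.2] at hcs
    norm_num at hcs

/-! ### Extension by deck transformations -/

section Deck

variable {φ : R3 ≃ R3}

theorem deck_apply (q : R4) : deck φ q = (φ q.1, q.2 - 1) := rfl

theorem deck_inv_apply (q : R4) : (deck φ)⁻¹ q = (φ.symm q.1, q.2 + 1) := rfl

theorem contDiff_deck (hφ : ContDiff ℝ ∞ φ) : ContDiff ℝ ∞ (deck φ) :=
  (hφ.comp contDiff_fst).prodMk (contDiff_snd.sub contDiff_const)

theorem contDiff_deck_inv (hφ' : ContDiff ℝ ∞ φ.symm) :
    ContDiff ℝ ∞ ((deck φ)⁻¹ : Equiv.Perm R4) :=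
  (hφ'.comp contDiff_fst).prodMk (contDiff_snd.add contDiff_const)

theorem contDiff_deck_zpow (hφ : ContDiff ℝ ∞ φ) (hφ' : ContDiff ℝ ∞ φ.symm) (n : ℤ) :
    ContDiff ℝ ∞ (deck φ ^ n : Equiv.Perm R4) := by
  induction n using Int.induction_on with
  | zero => exact contDiff_id
  | succ n ih =>
    rw [add_comm, zpow_add, zpow_one]
    exact (contDiff_deck hφ).comp ih
  | pred n ih =>
    rw [sub_eq_neg_add, zpow_add, zpow_neg_one]
    exact (contDiff_deck_inv hφ').comp ih

theorem deck_zpow_snd (n : ℤ) (q : R4) : ((deck φ ^ n : Equiv.Perm R4) q).2 = q.2 - n := by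
  induction n using Int.induction_on with
  | zero => simp
  | succ n ih =>
    rw [add_comm, zpow_add, zpow_one, Equiv.Perm.mul_apply, deck_apply, ih]
    push_cast
    ring
  | pred n ih =>
    rw [sub_eq_neg_add, zpow_add, zpow_neg_one, Equiv.Perm.mul_apply, deck_inv_apply, ih]
    push_cast
    ring

theorem toTorus_deck_zpow (n : ℤ) (q : R4) :
    toTorus φ ((deck φ ^ n : Equiv.Perm R4) q) = toTorus φ q :=
  Quotient.sound (s := MulAction.orbitRel (Subgroup.zpowers (deck φ)) R4)
    ⟨⟨deck φ ^ n, Subgroup.zpow_mem_zpowers _ _⟩, rfl⟩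

/-- Deck transformations carry curves tangent to an invariant distribution to such curves. -/
theorem deriv_deck_zpow_comp_mem (hφ : ContDiff ℝ ∞ φ) (hφ' : ContDiff ℝ ∞ φ.symm)
    {D : R4 → Submodule ℝ R4}
    (hD : ∀ q, (D q).map (fderiv ℝ (deck φ) q).toLinearMap = D (deck φ q)) {η : ℝ → R4} {θ : ℝ}
    (hη : DifferentiableAt ℝ η θ) (hηD : deriv η θ ∈ D (η θ)) (n : ℤ) :
    deriv (fun θ => (deck φ ^ n : Equiv.Perm R4) (η θ)) θ ∈
      D ((deck φ ^ n : Equiv.Perm R4) (η θ)) := by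
  have hdiff : ∀ n : ℤ, DifferentiableAt ℝ (fun θ => (deck φ ^ n : Equiv.Perm R4) (η θ)) θ :=
    fun n => ((contDiff_deck_zpow hφ hφ' n).differentiable (by simp) _).comp θ hη
  have hstep : ∀ n : ℤ, deriv (fun θ => (deck φ ^ (n + 1) : Equiv.Perm R4) (η θ)) θ =
      fderiv ℝ (deck φ) ((deck φ ^ n : Equiv.Perm R4) (η θ))
        (deriv (fun θ => (deck φ ^ n : Equiv.Perm R4) (η θ)) θ) := by
    intro n
    have h := ((contDiff_deck hφ).differentiable (by simp)
      ((deck φ ^ n : Equiv.Perm R4) (η θ))).hasFDerivAt.comp_hasDerivAt θ (hdiff n).hasDerivAt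
    rw [← h.deriv, add_comm, zpow_add, zpow_one]
    rfl
  have hinj : ∀ q, Function.Injective (fderiv ℝ (deck φ) q) := by
    intro q
    have h := ((contDiff_deck_inv hφ').differentiable (by simp) (deck φ q)).hasFDerivAt.comp q
      ((contDiff_deck hφ).differentiable (by simp) q).hasFDerivAt
    have hid : (((deck φ)⁻¹ : Equiv.Perm R4) ∘ deck φ : R4 → R4) = id :=
      funext fun q => (deck φ).symm_apply_apply q
    rw [hid] at h
    exact Function.LeftInverse.injective fun v =>
      DFunLike.congr_fun (h.unique (hasFDerivAt_id q)) v
  have hsucc : ∀ n : ℤ, (deck φ ^ (n + 1) : Equiv.Perm R4) (η θ) =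
      deck φ ((deck φ ^ n : Equiv.Perm R4) (η θ)) := by
    intro n
    rw [add_comm, zpow_add, zpow_one, Equiv.Perm.mul_apply]
  have hiff : ∀ n : ℤ, deriv (fun θ => (deck φ ^ (n + 1) : Equiv.Perm R4) (η θ)) θ ∈
      D ((deck φ ^ (n + 1) : Equiv.Perm R4) (η θ)) ↔
      deriv (fun θ => (deck φ ^ n : Equiv.Perm R4) (η θ)) θ ∈
      D ((deck φ ^ n : Equiv.Perm R4) (η θ)) := by
    intro n
    rw [hstep, hsucc, ← hD]
    exact Function.Injective.mem_set_image (hinj _)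
  induction n using Int.induction_on with
  | zero => simpa using hηD
  | succ n ih => exact (hiff _).2 ih
  | pred n ih => exact (hiff _).1 (by simpa using ih)

end Deck

/-- The extension of a family of arcs over `[0, 1]` to a family of curves over `ℝ` that is
equivariant under the deck transformation. -/
noncomputable def deckExtension (φ : R3 ≃ R3) (H : ℝ × ℝ → R4) (q : ℝ × ℝ) : R4 :=
  (deck φ ^ (-⌊q.2⌋) : Equiv.Perm R4) (H (q.1, Int.fract q.2))

section Extension

variable {φ : R3 ≃ R3} {H : ℝ × ℝ → R4} {s : ℝ} {δ : ℝ}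

theorem toTorus_deckExtension (q : ℝ × ℝ) :
    toTorus φ (deckExtension φ H q) = toTorus φ (H (q.1, Int.fract q.2)) :=
  toTorus_deck_zpow _ _

/-- If the arc is vertical near both ends and closes up, its extension has no seams: one formula is
valid on both sides of each integer. -/
theorem deckExtension_eq (hδ : δ ≤ 1) {p : R3} (hl : ∀ θ < (0 : ℝ), H (s, θ) = (p, θ))
    (hr : ∀ θ > 1 - δ, H (s, θ) = (φ.symm p, θ)) {n : ℤ} {θ : ℝ} (hθ : θ ∈ Ioo (n - δ) (n + 1)) :
    deckExtension φ H (s, θ) = (deck φ ^ (-n) : Equiv.Perm R4) (H (s, θ - n)) := by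
  rcases le_or_gt (n : ℝ) θ with h | h
  · have hfl : ⌊θ⌋ = n := Int.floor_eq_iff.2 ⟨h, hθ.2⟩
    simp only [deckExtension, Int.fract, hfl]
  · have hfl : ⌊θ⌋ = n - 1 := Int.floor_eq_iff.2 ⟨by push_cast; linarith [hθ.1], by
      push_cast; linarith⟩
    simp only [deckExtension, Int.fract, hfl]
    rw [hl (θ - n) (by linarith), hr (θ - (n - 1 : ℤ)) (by push_cast; linarith [hθ.1]), neg_sub,
      sub_eq_neg_add, zpow_add, zpow_one, Equiv.Perm.mul_apply, deck_apply]
    congr 2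
    · simp
    · push_cast
      ring

end Extension

/-- The intervals on which the formula of `deckExtension_eq` holds cover the line. -/
theorem exists_int_mem_Ioo {δ : ℝ} (hδ : 0 < δ) (θ : ℝ) : ∃ n : ℤ, θ ∈ Ioo (n - δ) (n + 1) :=
  ⟨⌊θ⌋, by linarith [Int.floor_le θ], Int.lt_floor_add_one θ⟩

/-! ### The deformation in the mapping torus -/

theorem proposition7 (φ : R3 ≃ R3) (hφ : IsContactomorphism φ) (h0 : φ 0 = 0)
    (lam : R3 → ℝ) (hlam : IsConformalFactor φ lam) (hlam0 : lam 0 ≠ 1)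
    (f : R4 → ℝ) (hf : IsSmallestTurning φ f) :
    -- the plane field of smallest turning is an Engel structure
    IsEngel (turningPlane f) ∧
    -- `γ` is an immersed loop tangent to the kernel `W`
    IsHorizontalImmersion (engelKernel (turningPlane f)) (zeroOrbit φ h0) ∧
    -- `γ` has a horizontal deformation leaving the curves tangent to `W` at once
    ∃ h : ℝ → S1 → MappingTorus φ,
      IsSmoothFamily h ∧
      h 0 = zeroOrbit φ h0 ∧
      (∀ s ∈ Set.Icc (0 : ℝ) 1, IsHorizontalImmersion (turningPlane f) (h s)) ∧
      ∀ s ∈ Set.Ioc (0 : ℝ) 1, SomewhereNotTangent (engelKernel (turningPlane f)) (h s) := by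
  have hker := fun {q v : R4} => mem_engelKernel (q := q) (v := v) hf.smooth hf.turning
  refine ⟨isEngel_turningPlane hf.smooth hf.turning, ?_, ?_⟩
  · refine ⟨fun θ => ((0 : R3), θ), ⟨contDiff_const.prodMk contDiff_id, fun θ => rfl⟩, fun θ => ?_⟩
    have hd : deriv (fun θ : ℝ => ((0 : R3), θ)) θ = ((0 : R3), (1 : ℝ)) :=
      ((hasDerivAt_const θ (0 : R3)).prodMk (hasDerivAt_id θ)).deriv
    rw [hd, hker]
    exact ⟨by simp, rfl⟩
  -- At the origin `α = dy`.
  have hlam' : ∀ v, (fderiv ℝ φ 0 v).2.1 = lam 0 * v.2.1 := by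
    intro v
    have := hlam 0 v
    rw [h0] at this
    simpa [contactForm] using this
  obtain ⟨H, hH0, hH⟩ := exists_horizontal_arcs hφ.smooth hφ.smooth_symm h0 hlam' hlam0 hf.smooth
    hf.turning
  have hform : ∀ᶠ s in 𝓝 (0 : ℝ), ∀ (n : ℤ), ∀ θ ∈ Ioo (n - 1 / 16 : ℝ) (n + 1),
      deckExtension φ H (s, θ) = (deck φ ^ (-n) : Equiv.Perm R4) (H (s, θ - n)) := by
    filter_upwards [hH] with s ⟨_, _, _, ⟨p, hl, hr⟩, _⟩ n θ hθ
    exact deckExtension_eq (by norm_num) (fun θ hθ => hl θ (by linarith))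
      (fun θ hθ => hr θ (by linarith)) hθ
  have hsmooth : ∀ᶠ s in 𝓝 (0 : ℝ), ∀ θ, ContDiffAt ℝ ∞ (deckExtension φ H) (s, θ) := by
    filter_upwards [hH, hform.eventually_nhds] with s hs hs' θ
    obtain ⟨n, hn⟩ := exists_int_mem_Ioo (by norm_num : (0 : ℝ) < 1 / 16) θ
    have h1 : ContDiffAt ℝ ∞ (fun q : ℝ × ℝ =>
        (deck φ ^ (-n) : Equiv.Perm R4) (H (q.1, q.2 - n))) (s, θ) :=
      (contDiff_deck_zpow hφ.smooth hφ.smooth_symm (-n)).contDiffAt.comp (s, θ)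
        ((hs.1 (θ - n)).comp (s, θ) (contDiffAt_fst.prodMk (contDiffAt_snd.sub contDiffAt_const)))
    refine h1.congr_of_eventuallyEq ?_
    filter_upwards [continuousAt_fst.eventually hs',
      continuousAt_snd.eventually (isOpen_Ioo.mem_nhds hn)] with q hq1 hq2
    exact hq1 n q.2 hq2
  obtain ⟨ε, hε, hball⟩ := Metric.eventually_nhds_iff.1 (hH.and (hform.and hsmooth))
  have hgood : ∀ s ∈ Icc (0 : ℝ) 1, dist (ε / 2 * s) 0 < ε := by
    intro s hs
    rw [dist_zero_right, Real.norm_of_nonneg (mul_nonneg (by linarith) hs.1)]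
    nlinarith [hs.2]
  have hper : ∀ s : ℝ, Function.Periodic
      (fun θ => toTorus φ (deckExtension φ H (ε / 2 * s, θ))) 1 := by
    intro s θ
    simp only [toTorus_deckExtension, Int.fract_add_one]
  have hlift : ∀ s ∈ Icc (0 : ℝ) 1, IsSmoothLift (φ := φ) (hper s).lift
      (fun θ => deckExtension φ H (ε / 2 * s, θ)) := by
    intro s hs
    refine ⟨contDiff_iff_contDiffAt.2 fun θ => ?_, fun θ => rfl⟩
    exact ((hball (hgood s hs)).2.2 θ).comp θ (contDiffAt_const.prodMk contDiffAt_id)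
  have hlocal : ∀ s ∈ Icc (0 : ℝ) 1, ∀ (n : ℤ), ∀ θ ∈ Ioo (n - 1 / 16 : ℝ) (n + 1),
      (fun θ => deckExtension φ H (ε / 2 * s, θ)) =ᶠ[𝓝 θ]
        fun θ => (deck φ ^ (-n) : Equiv.Perm R4) (H (ε / 2 * s, θ - n)) := by
    intro s hs n θ hθ
    filter_upwards [isOpen_Ioo.mem_nhds hθ] with θ' hθ'
    exact (hball (hgood s hs)).2.1 n θ' hθ'
  refine ⟨fun s => (hper s).lift, ⟨fun q => deckExtension φ H (ε / 2 * q.1, q.2), ?_,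
    fun s _ θ => rfl⟩, ?_, fun s hs => ⟨_, hlift s hs, fun θ => ?_⟩, fun s hs => ?_⟩
  · rintro ⟨s, θ⟩ ⟨hs, -⟩
    have h1 : ContDiffAt ℝ ∞ (fun q : ℝ × ℝ => (ε / 2 * q.1, q.2)) (s, θ) := by fun_prop
    exact (((hball (hgood s hs)).2.2 θ).comp (s, θ) h1).contDiffWithinAt
  · funext θ
    induction θ using QuotientAddGroup.induction_on with
    | H θ =>
      change toTorus φ (deckExtension φ H (ε / 2 * 0, θ)) = zeroOrbit φ h0 (θ : S1)
      rw [toTorus_deckExtension, mul_zero, hH0]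
      change zeroOrbit φ h0 ((Int.fract θ : ℝ) : S1) = zeroOrbit φ h0 (θ : S1)
      have hfl : ((⌊θ⌋ : ℝ) : S1) = 0 := (AddCircle.coe_eq_zero_iff 1).2 ⟨⌊θ⌋, by simp⟩
      rw [Int.fract, AddCircle.coe_sub, hfl, sub_zero]
  · obtain ⟨hs1, hsD, hsT, -, -⟩ := (hball (hgood s hs)).1
    obtain ⟨n, hn⟩ := exists_int_mem_Ioo (by norm_num : (0 : ℝ) < 1 / 16) θ
    have hev := hlocal s hs n θ hn
    have hshift : deriv (fun θ => H (ε / 2 * s, θ - n)) θ =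
        deriv (fun θ => H (ε / 2 * s, θ)) (θ - n) :=
      deriv_comp_sub_const (fun θ => H (ε / 2 * s, θ)) (n : ℝ) θ
    have hdiff : DifferentiableAt ℝ (fun θ => H (ε / 2 * s, θ - n)) θ :=
      ((hs1 (θ - n)).differentiableAt (by simp)).comp θ (by fun_prop)
    have hmem := deriv_deck_zpow_comp_mem hφ.smooth hφ.smooth_symm hf.invariant hdiff
      (hshift ▸ hsD (θ - n)) (-n)
    have hdiff' : DifferentiableAt ℝ
        (fun θ => (deck φ ^ (-n) : Equiv.Perm R4) (H (ε / 2 * s, θ - n))) θ :=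
      ((contDiff_deck_zpow hφ.smooth hφ.smooth_symm (-n)).differentiable (by simp) _).comp θ hdiff
    rw [hev.deriv_eq, hev.eq_of_nhds]
    refine ⟨fun h => ?_, hmem⟩
    -- Deck transformations act on the time by translations.
    have h1 : HasDerivAt
        (fun θ => ((deck φ ^ (-n) : Equiv.Perm R4) (H (ε / 2 * s, θ - n))).2) _ θ :=
      hasFDerivAt_snd.comp_hasDerivAt θ hdiff'.hasDerivAt
    simp only [deck_zpow_snd] at h1
    have h2 : HasDerivAt (fun θ => (H (ε / 2 * s, θ - n)).2 - ((-n : ℤ) : ℝ)) _ θ :=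
      (hasFDerivAt_snd.comp_hasDerivAt θ hdiff.hasDerivAt).sub_const _
    have h3 := h1.unique h2
    rw [h, hshift] at h3
    exact (hsT (θ - n)).ne h3
  · have hs' : s ∈ Icc (0 : ℝ) 1 := Ioc_subset_Icc_self hs
    refine ⟨_, hlift s hs', 3 / 4, ?_⟩
    have hev := hlocal s hs' 0 (3 / 4) (by norm_num)
    simp only [neg_zero, zpow_zero, Equiv.Perm.coe_one, id, Int.cast_zero, sub_zero] at hev
    rw [hker, hev.deriv_eq]
    exact (hball (hgood s hs')).1.2.2.2.2 (mul_ne_zero (by linarith) hs.1.ne')
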